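/- It is undecidable, given a deterministic pushdown automaton $M$ (accepting by final state, with no bound on the number of reversals of its pushdown), whether the language $L = L(M) \subseteq \Sigma^*$ that it accepts over its input alphabet $\Sigma$ is infix-dense, i.e. whether every word $w \in \Sigma^*$ is an infix of some word of $L$ ($\{w \in \Sigma^* \mid xwy \in L \text{ for some } x, y \in \Sigma^*\} = \Sigma^*$). That is, there is no algorithm that, for every deterministic pushdown automaton $M$ given as input by its finite description, halts and answers correctly whether $L(M)$ is infix-dense. -/

import Mathlib

/-- A transition of a pushdown automaton, i.e. one element `(target, push)` of
`δ(source, read, top)`. Here `read = none` means a move on the empty word, `read = some a` a move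
that consumes the input letter `a`; the topmost stack symbol `top` is replaced by the word `push`,
whose first letter becomes the new topmost symbol. -/
structure PDATransition where
  source : ℕ
  read : Option ℕ
  top : ℕ
  target : ℕ
  push : List ℕ

/-- A finite description of a pushdown automaton `(Q, Σ, Γ, δ, q₀, Z₀, F)`, where
`Q = {0, …, numStates - 1}`, `Σ = {0, …, numInput - 1}`, `Γ = {0, …, numStack - 1}`, `q₀ = start`,
`Z₀ = bottom`, `F` is the set of members of `final`, and `δ` is given by its list of transitions. -/
structure PDA where
  numStates : ℕ
  numInput : ℕ
  numStack : ℕ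
  start : ℕ
  bottom : ℕ
  final : List ℕ
  transitions : List PDATransition

/-- A transition is the same thing as the tuple of its components. -/
def PDATransition.equivTuple :
    PDATransition ≃ ℕ × Option ℕ × ℕ × ℕ × List ℕ where
  toFun t := (t.source, t.read, t.top, t.target, t.push)
  invFun x := ⟨x.1, x.2.1, x.2.2.1, x.2.2.2.1, x.2.2.2.2⟩
  left_inv _ := rfl
  right_inv _ := rfl

instance PDATransition.instPrimcodable : Primcodable PDATransition :=
  Primcodable.ofEquiv _ PDATransition.equivTuple

/-- A description of a pushdown automaton is the same thing as the tuple of its components. -/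
def PDA.equivTuple :
    PDA ≃ ℕ × ℕ × ℕ × ℕ × ℕ × List ℕ × List PDATransition where
  toFun M := (M.numStates, M.numInput, M.numStack, M.start, M.bottom, M.final, M.transitions)
  invFun x := ⟨x.1, x.2.1, x.2.2.1, x.2.2.2.1, x.2.2.2.2.1, x.2.2.2.2.2.1, x.2.2.2.2.2.2⟩
  left_inv _ := rfl
  right_inv _ := rfl

/-- Descriptions of pushdown automata are inputs of algorithms, through their tuples. -/
instance PDA.instPrimcodable : Primcodable PDA :=
  Primcodable.ofEquiv _ PDA.equivTuple

namespace PDA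

/-- All components of the description lie in the declared sets of states, input letters and stack
symbols. -/
def WellFormed (M : PDA) : Prop :=
  M.start < M.numStates ∧ M.bottom < M.numStack ∧ (∀ q ∈ M.final, q < M.numStates) ∧
    ∀ t ∈ M.transitions, t.source < M.numStates ∧ (∀ a ∈ t.read, a < M.numInput) ∧
      t.top < M.numStack ∧ t.target < M.numStates ∧ ∀ Z ∈ t.push, Z < M.numStack

/-- Determinism: each `δ(q, a, Z)` with `a ∈ Σ ∪ {λ}` has at most one element, and if
`δ(q, λ, Z)` is nonempty, then `δ(q, a, Z)` is empty for all `a ∈ Σ`. -/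
def Deterministic (M : PDA) : Prop :=
  (∀ t ∈ M.transitions, ∀ t' ∈ M.transitions,
    t.source = t'.source → t.read = t'.read → t.top = t'.top → t = t') ∧
  (∀ t ∈ M.transitions, ∀ t' ∈ M.transitions,
    t.source = t'.source → t.top = t'.top → t.read = none → t'.read = none)

/-- The description is one of a deterministic pushdown automaton. -/
def IsDPDA (M : PDA) : Prop := M.WellFormed ∧ M.Deterministic

/-- An instantaneous description: the state, the unread input, and the stack (topmost symbol
first). -/
structure Config where
  state : ℕ
  unread : List ℕ
  stack : List ℕ

/-- One move `(q, x w, Z β) ⊢ (p, w, γ β)`, where `x` is a letter or the empty word and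
`(p, γ) ∈ δ(q, x, Z)`. No move is possible when the stack is empty. -/
def Step (M : PDA) (c c' : Config) : Prop :=
  ∃ t ∈ M.transitions, ∃ w β : List ℕ,
    c = ⟨t.source, t.read.toList ++ w, t.top :: β⟩ ∧ c' = ⟨t.target, w, t.push ++ β⟩

/-- The language accepted by final state: the words `w` over `Σ` with
`(q₀, w, Z₀) ⊢* (q, λ, γ)` for some `q ∈ F` and some stack content `γ`. -/
def language (M : PDA) : Language (Fin M.numInput) :=
  {w | ∃ q ∈ M.final, ∃ γ : List ℕ,
    Relation.ReflTransGen M.Step ⟨M.start, w.map Fin.val, [M.bottom]⟩ ⟨q, [], γ⟩}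

end PDA

/-- The set of all infixes of the words of `L`. -/
def infixes {α : Type*} (L : Language α) : Language α :=
  {w | ∃ x y : List α, x ++ w ++ y ∈ L}

/-- `L` is infix-dense: every word over the alphabet is an infix of some word of `L`. -/
def IsInfixDense {α : Type*} (L : Language α) : Prop :=
  infixes L = Set.univ

/-- The problem "given `a` with `S a`, does `p a` hold?" is decidable: some algorithm halts with
the right answer on every `a` that satisfies `S`. (Nothing is asked of it on other inputs, on which
it need not even halt.) -/
def DecidableProblem {α : Type*} [Primcodable α] (S p : α → Prop) : Prop :=
  ∃ f : α →. Bool, Partrec f ∧ ∀ a, S a → ∃ b : Bool, b ∈ f a ∧ (b = true ↔ p a)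

/-! Non-halting of a deterministic multi-stack machine is reduced to infix-density. Reading the
symbols observed at each step determines the control states, so a claimed history is false only if
it misreports some stack, and one pushdown can check any single stack.

The automaton `checker` accepts everything that it can consume. A prefix of the input loads a list
of stack names. The input after it is cut into blocks by `sep`; at each separator that it reads, the
automaton drops one stack, takes the next name `i` and checks the following block against stack `i`
alone. After an error it skips to the next separator. It gets stuck if a block reaches a halting
state with no error visible on stack `i`.

If the machine halts, its true history between two separators passes every check, hence blocks the
automaton after any prefix (`not_consumes_of_halted`). If it does not halt, each block of a given
word either has a first error, and the name of that stack is loaded, or is true as far as it goes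
and ends in a non-halting state (`exists_consumes_of_not_halts`).

The machine is a `TM2` program for a universal partial recursive function. The input number affects
only the initial stacks, which makes the reduction primitive recursive. -/

/-! ### Deterministic pushdown automata over arbitrary types. -/

/-- A pushdown automaton over arbitrary types of states, letters and stack symbols, with a
deterministic transition function; every state is accepting. -/
structure DetPushdown (P A G : Type*) where
  δ : P → Option A → G → Option (P × List G)
  start : P
  bottom : G
  det : ∀ p g, (δ p none g).isSome → ∀ a, δ p (some a) g = none

namespace DetPushdown

variable {P A G : Type*} (D : DetPushdown P A G)

/-- One move between instantaneous descriptions (state, unread input, stack). -/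
def Step (c c' : P × List A × List G) : Prop :=
  ∃ p a g w β r, c = (p, Option.toList a ++ w, g :: β) ∧ D.δ p a g = some r ∧
    c' = (r.1, w, r.2 ++ β)

/-- The whole unread input can be consumed. -/
def Consumes (c : P × List A × List G) : Prop :=
  ∃ p st, Relation.ReflTransGen D.Step c (p, [], st)

variable {D}

theorem Consumes.of_nil (p : P) (st : List G) : D.Consumes (p, [], st) :=
  ⟨p, st, .refl⟩

theorem Consumes.head {c c' : P × List A × List G} (h : D.Step c c') (h' : D.Consumes c') :
    D.Consumes c :=
  let ⟨p, st, h'⟩ := h'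
  ⟨p, st, h'.head h⟩

theorem Consumes.read {p : P} {a : A} {g : G} {w : List A} {β : List G} {p' : P} {γ : List G}
    (h : D.δ p (some a) g = some (p', γ)) (h' : D.Consumes (p', w, γ ++ β)) :
    D.Consumes (p, a :: w, g :: β) :=
  .head ⟨p, some a, g, w, β, _, rfl, h, rfl⟩ h'

theorem Consumes.silent {p : P} {g : G} {w : List A} {β : List G} {p' : P} {γ : List G}
    (h : D.δ p none g = some (p', γ)) (h' : D.Consumes (p', w, γ ++ β)) :
    D.Consumes (p, w, g :: β) :=
  .head ⟨p, none, g, w, β, _, rfl, h, rfl⟩ h'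

theorem Consumes.induction {motive : P × List A × List G → Prop}
    (nil : ∀ p st, motive (p, [], st))
    (step : ∀ c c', D.Step c c' → D.Consumes c' → motive c' → motive c)
    {c : P × List A × List G} (h : D.Consumes c) : motive c := by
  obtain ⟨p, st, h⟩ := h
  induction h using Relation.ReflTransGen.head_induction_on with
  | refl => exact nil p st
  | head h h' ih => exact step _ _ h ⟨_, _, h'⟩ ih

/-- A configuration with unread input that can be consumed makes a move. -/
theorem Consumes.exists_step {p : P} {u : List A} {st : List G} (h : D.Consumes (p, u, st))
    (hu : u ≠ []) :
    ∃ g β r, st = g :: β ∧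
      (D.δ p none g = some r ∧ D.Consumes (r.1, u, r.2 ++ β) ∨
        ∃ a w, u = a :: w ∧ D.δ p (some a) g = some r ∧ D.Consumes (r.1, w, r.2 ++ β)) := by
  obtain ⟨p', st', h⟩ := h
  rcases Relation.ReflTransGen.cases_head h with h' | ⟨c, ⟨p, a, g, w, β, r, hc, hr, rfl⟩, h'⟩
  · simp_all
  · simp only [Prod.mk.injEq] at hc
    obtain ⟨rfl, rfl, rfl⟩ := hc
    refine ⟨g, β, r, rfl, ?_⟩
    cases a with
    | none => exact .inl ⟨hr, _, _, h'⟩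
    | some a => exact .inr ⟨a, w, rfl, hr, _, _, h'⟩

/-! ### Numbering states, letters and stack symbols. -/

section Encode

variable [Fintype P] [Fintype A] [Fintype G] (D)

/-- The number of an element of a finite type. -/
noncomputable def num {α : Type*} [Fintype α] (a : α) : ℕ := Fintype.equivFin α a

theorem num_lt {α : Type*} [Fintype α] (a : α) : num a < Fintype.card α := (Fintype.equivFin α a).2

theorem num_injective {α : Type*} [Fintype α] : Function.Injective (num : α → ℕ) :=
  Fin.val_injective.comp (Fintype.equivFin α).injective

@[simp] theorem num_inj {α : Type*} [Fintype α] {a b : α} : num a = num b ↔ a = b :=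
  num_injective.eq_iff

/-- The transitions described by one value of the transition function. -/
noncomputable def transitionsAt (x : P × Option A × G) : List PDATransition :=
  ((D.δ x.1 x.2.1 x.2.2).map fun r =>
    (⟨num x.1, x.2.1.map num, num x.2.2, num r.1, r.2.map num⟩ : PDATransition)).toList

/-- The finite description. -/
noncomputable def toPDA : PDA where
  numStates := Fintype.card P
  numInput := Fintype.card A
  numStack := Fintype.card G
  start := num D.start
  bottom := num D.bottom
  final := List.range (Fintype.card P)
  transitions := (Finset.univ : Finset (P × Option A × G)).toList.flatMap D.transitionsAt

theorem mem_transitions {t : PDATransition} :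
    t ∈ D.toPDA.transitions ↔ ∃ p a g r, D.δ p a g = some r ∧
      t = ⟨num p, a.map num, num g, num r.1, r.2.map num⟩ := by
  simp only [toPDA, transitionsAt, List.mem_flatMap, Finset.mem_toList, Finset.mem_univ, true_and,
    Option.mem_toList, Option.map_eq_some_iff, Prod.exists]
  constructor
  · rintro ⟨p, a, g, p', γ, h, rfl⟩
    exact ⟨p, a, g, p', γ, h, rfl⟩
  · rintro ⟨p, a, g, p', γ, h, rfl⟩
    exact ⟨p, a, g, p', γ, h, rfl⟩

theorem isDPDA_toPDA : D.toPDA.IsDPDA := by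
  refine ⟨⟨num_lt _, num_lt _, fun q hq => List.mem_range.1 hq, ?_⟩, ?_, ?_⟩
  · intro t ht
    obtain ⟨p, a, g, r, -, rfl⟩ := D.mem_transitions.1 ht
    refine ⟨num_lt _, ?_, num_lt _, num_lt _, ?_⟩
    · rintro b hb
      obtain ⟨a, -, rfl⟩ := Option.map_eq_some_iff.1 hb
      exact num_lt _
    · intro Z hZ
      obtain ⟨g, -, rfl⟩ := List.mem_map.1 hZ
      exact num_lt _
  · intro t ht t' ht' h₁ h₂ h₃
    obtain ⟨p, a, g, r, hr, rfl⟩ := D.mem_transitions.1 ht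
    obtain ⟨p', a', g', r', hr', rfl⟩ := D.mem_transitions.1 ht'
    obtain rfl := num_injective h₁
    obtain rfl := Option.map_injective num_injective h₂
    obtain rfl := num_injective h₃
    obtain rfl : r = r' := by simpa [hr] using hr'
    rfl
  · intro t ht t' ht' h₁ h₂ h₃
    obtain ⟨p, a, g, r, hr, rfl⟩ := D.mem_transitions.1 ht
    obtain ⟨p', a', g', r', hr', rfl⟩ := D.mem_transitions.1 ht'
    obtain rfl := num_injective h₁
    obtain rfl := num_injective h₂
    obtain rfl : a = none := by simpa using h₃
    cases a' with
    | none => rfl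
    | some a' => simp [D.det p g (by simp [hr]) a'] at hr'

/-- The numbered version of an instantaneous description. -/
noncomputable def encodeConfig (c : P × List A × List G) : PDA.Config :=
  ⟨num c.1, c.2.1.map num, c.2.2.map num⟩

/-- The target `d` is arbitrary because runs of the numbered automaton must be shown never to leave
the encoded configurations. -/
theorem step_encodeConfig {c : P × List A × List G} {d : PDA.Config} :
    D.toPDA.Step (encodeConfig c) d ↔ ∃ c', D.Step c c' ∧ d = encodeConfig c' := by
  constructor
  · rintro ⟨t, ht, w, β, hc, rfl⟩
    obtain ⟨p, a, g, r, hr, rfl⟩ := D.mem_transitions.1 ht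
    obtain ⟨p', u, st⟩ := c
    simp only [encodeConfig, PDA.Config.mk.injEq, num_inj, List.map_eq_append_iff,
      List.map_eq_cons_iff] at hc
    obtain ⟨rfl, ⟨u₁, w, rfl, hu, rfl⟩, g', β, rfl, hg, rfl⟩ := hc
    subst hg
    have : u₁ = a.toList := by
      cases a with
      | none => simpa using hu
      | some a => simpa [List.map_eq_cons_iff] using hu
    subst this
    exact ⟨_, ⟨p', a, g', w, β, r, rfl, hr, rfl⟩, by simp [encodeConfig]⟩
  · rintro ⟨c', ⟨p, a, g, w, β, r, rfl, hr, rfl⟩, rfl⟩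
    refine ⟨_, D.mem_transitions.2 ⟨p, a, g, r, hr, rfl⟩, w.map num, β.map num, ?_, ?_⟩
    · cases a <;> simp [encodeConfig]
    · simp [encodeConfig]

theorem reaches_encodeConfig {c : P × List A × List G} {d : PDA.Config} :
    Relation.ReflTransGen D.toPDA.Step (encodeConfig c) d ↔
      ∃ c', Relation.ReflTransGen D.Step c c' ∧ d = encodeConfig c' := by
  constructor
  · intro h
    induction h with
    | refl => exact ⟨c, .refl, rfl⟩
    | tail _ h ih =>
      obtain ⟨c', hc', rfl⟩ := ih
      obtain ⟨c'', hc'', rfl⟩ := D.step_encodeConfig.1 h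
      exact ⟨c'', hc'.tail hc'', rfl⟩
  · rintro ⟨c', h, rfl⟩
    induction h with
    | refl => exact .refl
    | tail _ h ih => exact ih.tail (D.step_encodeConfig.2 ⟨_, h, rfl⟩)

theorem mem_language_toPDA (w : List A) :
    w.map (Fintype.equivFin A) ∈ D.toPDA.language ↔ D.Consumes (D.start, w, [D.bottom]) := by
  have key : (⟨D.toPDA.start, (w.map (Fintype.equivFin A)).map Fin.val, [D.toPDA.bottom]⟩ :
      PDA.Config) = encodeConfig (D.start, w, [D.bottom]) := by
    simp only [encodeConfig, toPDA, List.map_map, List.map_cons, List.map_nil]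
    rfl
  change (∃ q ∈ D.toPDA.final, ∃ γ : List ℕ, Relation.ReflTransGen D.toPDA.Step
    ⟨D.toPDA.start, (w.map (Fintype.equivFin A)).map Fin.val, [D.toPDA.bottom]⟩ ⟨q, [], γ⟩) ↔ _
  rw [key]
  simp only [reaches_encodeConfig]
  constructor
  · rintro ⟨q, -, γ, ⟨p, u, st⟩, h, e⟩
    simp only [encodeConfig, PDA.Config.mk.injEq, List.nil_eq, List.map_eq_nil_iff] at e
    obtain ⟨-, rfl, -⟩ := e
    exact ⟨p, st, h⟩
  · rintro ⟨p, st, h⟩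
    exact ⟨num p, List.mem_range.2 (num_lt p), st.map num, _, h, rfl⟩

theorem isInfixDense_toPDA :
    IsInfixDense D.toPDA.language ↔
      ∀ w : List A, ∃ x y, D.Consumes (D.start, x ++ w ++ y, [D.bottom]) := by
  have surj : Function.Surjective (List.map (Fintype.equivFin A)) :=
    List.map_surjective_iff.2 (Fintype.equivFin A).surjective
  refine (Set.eq_univ_iff_forall (s := {w | ∃ x y, x ++ w ++ y ∈ D.toPDA.language})).trans ?_
  change (∀ w : List (Fin (Fintype.card A)), ∃ x y : List (Fin (Fintype.card A)),
    x ++ w ++ y ∈ D.toPDA.language) ↔ _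
  rw [surj.forall]
  refine forall_congr' fun w => ?_
  rw [surj.exists]
  refine exists_congr fun x => ?_
  rw [surj.exists]
  refine exists_congr fun y => ?_
  rw [← mem_language_toPDA, List.map_append, List.map_append]

end Encode

end DetPushdown

/-! ### Multi-stack machines and their histories. -/

/-- A deterministic machine with a family of stacks: in control state `q`, it observes the top of
the stack `sel q` (`none` if that stack is empty), replaces it by a word, and moves to the next
control state. -/
structure StackMachine (Q K Γ : Type*) where
  start : Q
  sel : Q → K
  out : Q → Option Γ → List Γ
  next : Q → Option Γ → Q
  halted : Q → Prop

namespace StackMachine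

variable {Q K Γ : Type*}

/-- The content of the pushdown store that represents stack `i` above the names `st`. -/
def store (γ : List Γ) (i : K) (st : List (Γ ⊕ K)) : List (Γ ⊕ K) := γ.map .inl ++ .inr i :: st

theorem exists_store_eq_cons (γ : List Γ) (i : K) (st : List (Γ ⊕ K)) :
    ∃ g β, store γ i st = g :: β ∧ g.getLeft? = γ.head? ∧
      (g.getRight?.map .inr).toList ++ β = store γ.tail i st := by
  cases γ with
  | nil => exact ⟨.inr i, st, rfl, rfl, rfl⟩
  | cons a γ => exact ⟨.inl a, store γ i st, rfl, rfl, rfl⟩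

variable [DecidableEq K] (M : StackMachine Q K Γ)

/-- The observed stack symbol. -/
def observed (c : Q × (K → List Γ)) : Option Γ := (c.2 (M.sel c.1)).head?

/-- One step. -/
def step (c : Q × (K → List Γ)) : Q × (K → List Γ) :=
  (M.next c.1 (M.observed c), Function.update c.2 (M.sel c.1)
    (M.out c.1 (M.observed c) ++ (c.2 (M.sel c.1)).tail))

/-- A halting control state is reached. -/
def Halts (c : Q × (K → List Γ)) : Prop := ∃ n, M.halted (M.step^[n] c).1

/-- The word of the symbols observed during `n` steps. -/
def history : ℕ → Q × (K → List Γ) → List (Option Γ)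
  | 0, _ => []
  | n + 1, c => M.observed c :: history n (M.step c)

theorem Halts.of_step {c : Q × (K → List Γ)} (h : M.Halts (M.step c)) : M.Halts c :=
  let ⟨n, h⟩ := h
  ⟨n + 1, h⟩

/-- The restriction to a set of control states that is closed under `next`. -/
def restrict (s : Set Q) (h₀ : M.start ∈ s) (h : ∀ q ∈ s, ∀ o, M.next q o ∈ s) :
    StackMachine s K Γ where
  start := ⟨M.start, h₀⟩
  sel q := M.sel q
  out q := M.out q
  next q o := ⟨M.next q o, h q q.2 o⟩
  halted q := M.halted q

theorem halts_restrict {s : Set Q} (h₀ : M.start ∈ s) (h : ∀ q ∈ s, ∀ o, M.next q o ∈ s)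
    (q : s) (S : K → List Γ) : (M.restrict s h₀ h).Halts (q, S) ↔ M.Halts (q, S) := by
  refine exists_congr fun n => ?_
  have : ∀ (n : ℕ) (q : s) (S : K → List Γ), M.step^[n] (q, S) =
      ((((M.restrict s h₀ h).step^[n] (q, S)).1 : Q), ((M.restrict s h₀ h).step^[n] (q, S)).2) := by
    intro n
    induction n with
    | zero => intros; rfl
    | succ n ih =>
      intro q S
      exact ih ⟨M.next q (M.observed (q, S)), h q q.2 _⟩ _
  rw [this]
  rfl

/-! ### The history checker and its infix-density. -/

/-- Control states of the history checker. -/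
inductive CheckState (Q K : Type*)
  | load
  | found
  | restart
  | enter
  | run (i : K) (q : Q)

/-- Letters read by the history checker. -/
inductive CheckLetter (K Γ : Type*)
  | obs (o : Option Γ)
  | mode (i : K)
  | go
  | sep

instance [Finite Q] [Finite K] : Finite (CheckState Q K) :=
  Finite.of_surjective (α := Fin 4 ⊕ K × Q)
    (Sum.elim ![.load, .found, .restart, .enter] fun x => .run x.1 x.2) fun
    | .load => ⟨.inl 0, rfl⟩
    | .found => ⟨.inl 1, rfl⟩
    | .restart => ⟨.inl 2, rfl⟩
    | .enter => ⟨.inl 3, rfl⟩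
    | .run i q => ⟨.inr (i, q), rfl⟩

instance [Finite K] [Finite Γ] : Finite (CheckLetter K Γ) :=
  Finite.of_surjective (α := Option Γ ⊕ K ⊕ Fin 2)
    (Sum.elim .obs (Sum.elim .mode ![.go, .sep])) fun
    | .obs o => ⟨.inl o, rfl⟩
    | .mode i => ⟨.inr (.inl i), rfl⟩
    | .go => ⟨.inr (.inr 0), rfl⟩
    | .sep => ⟨.inr (.inr 1), rfl⟩

open CheckState CheckLetter

open Classical in
/-- The transition function of the history checker for the initial stacks `S₀`. -/
noncomputable def checkStep (S₀ : K → List Γ) :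
    CheckState Q K → Option (CheckLetter K Γ) → Γ ⊕ K → Option (CheckState Q K × List (Γ ⊕ K))
  | load, some (mode i), g => some (load, [.inr i, g])
  | load, some go, g => some (found, [g])
  | found, some sep, g => some (restart, [g])
  | found, some _, g => some (found, [g])
  -- A name marks the bottom of the simulated stack: symbols are popped down to it, the name is
  -- popped too, and the name below selects the next check.
  | restart, none, .inl _ => some (restart, [])
  | restart, none, .inr _ => some (enter, [])
  | enter, none, .inr i => some (run i M.start, (S₀ i).map .inl ++ [.inr i])
  | run _ q, some sep, g => if M.halted q then none else some (restart, [g])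
  | run i q, some (obs o), g =>
    if M.sel q = i then
      if o = g.getLeft? then
        -- If the simulated stack is empty, `g` is its name and must be put back.
        some (run i (M.next q o), (M.out q o).map .inl ++ (g.getRight?.map .inr).toList)
      else some (found, [g])
    -- Observations of other stacks are taken on trust.
    else some (run i (M.next q o), [g])
  | run _ _, some _, g => some (found, [g])
  | _, _, _ => none

/-- The history checker. It first loads a list of stack names. Afterwards, it consumes a
name per block of input between separators, and gets stuck at the end of a block that is a halting
history as far as the stack with this name can tell. -/
noncomputable def checker (S₀ : K → List Γ) (i₀ : K) :
    DetPushdown (CheckState Q K) (CheckLetter K Γ) (Γ ⊕ K) where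
  δ := M.checkStep S₀
  start := load
  bottom := .inr i₀
  det p g h a := by
    cases p <;> rcases g with g | g <;> simp [checkStep] at h ⊢

variable {M} {S₀ : K → List Γ} {i₀ : K}

theorem consumes_restart {v : List (CheckLetter K Γ)} {i j : K} {st : List (Γ ⊕ K)}
    (h : (M.checker S₀ i₀).Consumes (run j M.start, v, store (S₀ j) j st)) (γ : List Γ) :
    (M.checker S₀ i₀).Consumes (restart, v, store γ i (.inr j :: st)) := by
  induction γ with
  | nil =>
    refine .silent (p' := enter) (γ := []) rfl (.silent (p' := run j M.start) rfl ?_)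
    simpa [store] using h
  | cons a γ ih => exact .silent (p' := restart) (γ := []) rfl ih

theorem consumes_run_match {v : List (CheckLetter K Γ)} {q : Q} {S : K → List Γ} {i : K}
    {st : List (Γ ⊕ K)}
    (h : (M.checker S₀ i₀).Consumes (run i (M.step (q, S)).1, v, store ((M.step (q, S)).2 i) i st)) :
    (M.checker S₀ i₀).Consumes (run i q, obs (M.observed (q, S)) :: v, store (S i) i st) := by
  obtain ⟨g, β, e, h₁, h₂⟩ := exists_store_eq_cons (S i) i st
  rw [e]
  by_cases hi : M.sel q = i
  · subst hi
    refine .read (p' := run (M.sel q) (M.step (q, S)).1) (γ := (M.out q (M.observed (q, S))).map .inl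
      ++ (g.getRight?.map .inr).toList) ?_ ?_
    · simp [checker, checkStep, h₁, observed, step]
    · rw [List.append_assoc, h₂]
      simpa [step, store] using h
  · refine .read (p' := run i (M.step (q, S)).1) (γ := [g]) ?_ ?_
    · simp [checker, checkStep, hi, step]
    · rw [List.singleton_append, ← e]
      simpa [step, Function.update_of_ne (Ne.symm hi)] using h

theorem consumes_run_mismatch {v : List (CheckLetter K Γ)} {q : Q} {S : K → List Γ} {o : Option Γ}
    {st : List (Γ ⊕ K)} (ho : o ≠ M.observed (q, S))
    (h : (M.checker S₀ i₀).Consumes (found, v, store (S (M.sel q)) (M.sel q) st)) :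
    (M.checker S₀ i₀).Consumes (run (M.sel q) q, obs o :: v, store (S (M.sel q)) (M.sel q) st) := by
  obtain ⟨g, β, e, h₁, -⟩ := exists_store_eq_cons (S (M.sel q)) (M.sel q) st
  rw [e] at h ⊢
  refine .read (p' := found) (γ := [g]) ?_ h
  simp [checker, checkStep, h₁, show o ≠ (S (M.sel q)).head? from ho]

theorem consumes_keep {p p' : CheckState Q K} {a : CheckLetter K Γ} {v : List (CheckLetter K Γ)}
    {γ : List Γ} {i : K} {st : List (Γ ⊕ K)}
    (hp : ∀ g, M.checkStep S₀ p (some a) g = some (p', [g]))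
    (h : (M.checker S₀ i₀).Consumes (p', v, store γ i st)) : (M.checker S₀ i₀).Consumes (p, a :: v, store γ i st) := by
  obtain ⟨g, β, e, -⟩ := exists_store_eq_cons γ i st
  rw [e] at h ⊢
  exact .read (hp g) h

/-- If the machine does not halt, then every word can be consumed with suitable names. -/
theorem exists_consumes_of_not_halts (h₀ : ¬ M.Halts (M.start, S₀)) (v : List (CheckLetter K Γ)) :
    (∀ q S, ¬ M.Halts (q, S) → ∃ i is, ∀ st,
      (M.checker S₀ i₀).Consumes (run i q, v, store (S i) i (List.map .inr is ++ st))) ∧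
    (∃ is, ∀ γ i st, (M.checker S₀ i₀).Consumes (found, v, store γ i (List.map .inr is ++ st))) ∧
    (∃ is, ∀ γ i st, (M.checker S₀ i₀).Consumes (restart, v, store γ i (List.map .inr is ++ st))) := by
  have restart_of_run : ∀ v : List (CheckLetter K Γ), (∃ i is, ∀ st,
      (M.checker S₀ i₀).Consumes (run i M.start, v, store (S₀ i) i (List.map .inr is ++ st))) →
      ∃ is, ∀ γ i st, (M.checker S₀ i₀).Consumes (restart, v, store γ i (List.map .inr is ++ st)) := by
    rintro v ⟨i, is, h⟩
    -- The current content `γ` and its name `j` are discarded, so only the next name `i` matters.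
    exact ⟨i :: is, fun γ j st => consumes_restart (h st) γ⟩
  induction v with
  | nil =>
    exact ⟨fun _ _ _ => ⟨i₀, [], fun _ => .of_nil _ _⟩, ⟨[], fun _ _ _ => .of_nil _ _⟩,
      restart_of_run _ ⟨i₀, [], fun _ => .of_nil _ _⟩⟩
  | cons a v ih =>
    obtain ⟨ihRun, ⟨isF, ihFound⟩, ⟨isR, ihRestart⟩⟩ := ih
    have hRun : ∀ q S, ¬ M.Halts (q, S) → ∃ i is, ∀ st,
        (M.checker S₀ i₀).Consumes (run i q, a :: v, store (S i) i (List.map .inr is ++ st)) := by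
      intro q S hq
      cases a with
      | mode | go =>
        exact ⟨i₀, isF, fun st => consumes_keep (fun g => by simp [checkStep]) (ihFound _ _ st)⟩
      | sep =>
        refine ⟨i₀, isR, fun st => consumes_keep (p' := restart) (fun g => ?_) (ihRestart _ _ st)⟩
        simp [checkStep, show ¬ M.halted q from fun h => hq ⟨0, h⟩]
      | obs o =>
        by_cases ho : o = M.observed (q, S)
        · subst ho
          -- A correct observation suits every name, so the choice is left to the rest of the word.
          obtain ⟨i, is, h⟩ := ihRun _ _ (fun h => hq (Halts.of_step M (c := (q, S)) h))
          exact ⟨i, is, fun st => consumes_run_match (h st)⟩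
        -- At the first false observation, the name of the misreported stack is the right choice.
        · exact ⟨M.sel q, isF, fun st => consumes_run_mismatch ho (ihFound _ _ st)⟩
    refine ⟨hRun, ?_, restart_of_run _ (hRun _ _ h₀)⟩
    cases a with
    | sep =>
      exact ⟨isR, fun γ i st => consumes_keep (fun g => by simp [checkStep]) (ihRestart _ _ st)⟩
    | _ =>
      exact ⟨isF, fun γ i st => consumes_keep (fun g => by simp [checkStep]) (ihFound _ _ st)⟩

/-- Each name goes on top of the earlier ones, hence the reversal. -/
theorem consumes_load (is : List K) {v : List (CheckLetter K Γ)} {st : List (Γ ⊕ K)} {i : K}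
    (h : (M.checker S₀ i₀).Consumes (load, v, List.map .inr is ++ .inr i :: st)) :
    (M.checker S₀ i₀).Consumes (load, (is.map mode).reverse ++ v, .inr i :: st) := by
  induction is generalizing v with
  | nil => exact h
  | cons j is ih =>
    rw [List.map_cons, List.reverse_cons, List.append_assoc]
    refine ih ?_
    -- The move rewrites the top symbol, so the split only serves to exhibit it.
    cases is with
    | nil => exact .read (p' := load) (γ := [.inr j, .inr i]) rfl h
    | cons k is => exact .read (p' := load) (γ := [.inr j, .inr k]) rfl h

/-- A valid halting history is a dead end for every choice of the name. -/
theorem not_consumes_history {n : ℕ} {q : Q} {S : K → List Γ} {i : K} {st : List (Γ ⊕ K)}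
    {y : List (CheckLetter K Γ)} (hn : M.halted (M.step^[n] (q, S)).1) :
    ¬ (M.checker S₀ i₀).Consumes (run i q, (M.history n (q, S)).map obs ++ sep :: y, store (S i) i st) := by
  induction n generalizing q S with
  | zero =>
    intro h
    obtain ⟨g, β, r, -, h | ⟨a, w, e, h, -⟩⟩ := h.exists_step (by simp)
    · simp [checker, checkStep] at h
    · simp only [history, List.map_nil, List.nil_append, List.cons.injEq] at e
      obtain ⟨rfl, rfl⟩ := e
      simp [checker, checkStep, show M.halted q from hn] at h
  | succ n ih =>
    intro h
    obtain ⟨g, β, r, hs, h | ⟨a, w, e, h, h'⟩⟩ := h.exists_step (by simp)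
    · simp [checker, checkStep] at h
    · simp only [history, List.map_cons, List.cons_append, List.cons.injEq] at e
      obtain ⟨rfl, rfl⟩ := e
      refine ih (q := (M.step (q, S)).1) (S := (M.step (q, S)).2) hn ?_
      obtain ⟨g', β', e, h₁, h₂⟩ := exists_store_eq_cons (S i) i st
      obtain ⟨rfl, rfl⟩ : g' = g ∧ β' = β := by simpa using e.symm.trans hs
      by_cases hi : M.sel q = i
      · subst hi
        have : M.observed (q, S) = g'.getLeft? := h₁.symm
        simp only [checker, checkStep, this, if_true, Option.some.injEq] at h
        subst h
        rw [List.append_assoc, h₂] at h'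
        simpa [step, store, this] using h'
      · simp only [checker, checkStep, hi, if_false, Option.some.injEq] at h
        subst h
        rw [List.singleton_append, ← e] at h'
        simpa [step, Function.update_of_ne (Ne.symm hi)] using h'

theorem not_consumes_enter {n : ℕ} (hn : M.halted (M.step^[n] (M.start, S₀)).1)
    {st : List (Γ ⊕ K)} {y : List (CheckLetter K Γ)} :
    ¬ (M.checker S₀ i₀).Consumes (enter, (M.history n (M.start, S₀)).map obs ++ sep :: y, st) := by
  intro h
  obtain ⟨g, β, r, rfl, h | ⟨a, w, e, h, -⟩⟩ := h.exists_step (by simp)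
  · rcases g with g | i
    · simp [checker, checkStep] at h
    · obtain ⟨hr, h⟩ := h
      obtain rfl : (run i M.start, (S₀ i).map .inl ++ [.inr i]) = r := by
        simpa [checker, checkStep] using hr
      refine not_consumes_history (S₀ := S₀) (i₀ := i₀) (i := i) (st := β) (y := y) hn ?_
      simpa [store] using h
  · simp [checker, checkStep] at h

/-- Each silent move of `restart` shortens the store. Either it runs empty, which blocks the
automaton, or some name is popped and `enter` takes over. -/
theorem not_consumes_restart {n : ℕ} (hn : M.halted (M.step^[n] (M.start, S₀)).1)
    {st : List (Γ ⊕ K)} {y : List (CheckLetter K Γ)} :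
    ¬ (M.checker S₀ i₀).Consumes (restart, (M.history n (M.start, S₀)).map obs ++ sep :: y, st) := by
  induction st with
  | nil =>
    intro h
    obtain ⟨g, β, r, e, -⟩ := h.exists_step (by simp)
    simp at e
  | cons g st ih =>
    intro h
    obtain ⟨g, β, r, e, h | ⟨a, w, -, h, -⟩⟩ := h.exists_step (by simp)
    · obtain ⟨rfl, rfl⟩ := List.cons.inj e
      rcases g with g | i
      · simp only [checker, checkStep, Option.some.injEq] at h
        obtain ⟨rfl, h⟩ := h
        exact ih h
      · simp only [checker, checkStep, Option.some.injEq] at h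
        obtain ⟨rfl, h⟩ := h
        exact not_consumes_enter hn h
    · simp [checker, checkStep] at h

/-- A valid halting history between separators cannot be consumed after any prefix. -/
theorem not_consumes_of_halted {n : ℕ} (hn : M.halted (M.step^[n] (M.start, S₀)).1)
    {c : CheckState Q K × List (CheckLetter K Γ) × List (Γ ⊕ K)} (hc : (M.checker S₀ i₀).Consumes c)
    (x y : List (CheckLetter K Γ)) :
    c.2.1 ≠ x ++ sep :: ((M.history n (M.start, S₀)).map obs ++ sep :: y) := by
  revert x
  refine hc.induction (motive := fun c => ∀ x, c.2.1 ≠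
    x ++ sep :: ((M.history n (M.start, S₀)).map obs ++ sep :: y)) (fun p st => by simp) ?_
  · rintro _ _ ⟨p, a, g, w, β, r, rfl, hr, rfl⟩ hc' ih x hx
    cases a with
    | none => exact ih x hx
    | some a =>
      cases x with
      | cons b x => exact ih x (List.cons.inj hx).2
      | nil =>
        obtain ⟨rfl, rfl⟩ := List.cons.inj hx
        obtain ⟨p', γ⟩ := r
        -- Whatever the state, a separator that can be read leads to `restart`.
        have : p' = restart := by
          cases p <;> simp [checker, checkStep] at hr <;> simp_all
        subst this
        exact not_consumes_restart hn hc'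

/-- The language of the history checker is infix-dense iff the machine does not halt. -/
theorem checker_infixDense_iff :
    (∀ w, ∃ x y, (M.checker S₀ i₀).Consumes ((M.checker S₀ i₀).start, x ++ w ++ y,
      [(M.checker S₀ i₀).bottom])) ↔ ¬ M.Halts (M.start, S₀) := by
  constructor
  · rintro h ⟨n, hn⟩
    obtain ⟨x, y, h⟩ := h (sep :: ((M.history n (M.start, S₀)).map obs ++ [sep]))
    exact not_consumes_of_halted hn h x y (by simp)
  · intro h w
    obtain ⟨is, hw⟩ := (exists_consumes_of_not_halts (i₀ := i₀) h w).2.1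
    -- The extra `i₀` on top names an empty stack, which the first `restart` discards before the
    -- names in `is` are used.
    refine ⟨((i₀ :: is).map mode).reverse ++ [go], [], ?_⟩
    rw [List.append_nil, List.append_assoc]
    refine consumes_load (i₀ :: is) ?_
    exact .read (p' := found) (γ := [.inr i₀]) rfl (hw [] i₀ [.inr i₀])

end StackMachine

/-! ### Executing `TM2` programs statement by statement. -/

namespace StackMachine

open Turing

variable {K Γ Λ σ : Type*} {M : Λ → TM2.Stmt (fun _ : K => Γ) Λ σ}

theorem toList_head?_append_tail {α : Type*} (l : List α) : l.head?.toList ++ l.tail = l := by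
  cases l <;> rfl

theorem eval_step_some [DecidableEq K] (l : Λ) (v : σ) (S : K → List Γ) :
    StateTransition.eval (TM2.step M) ⟨some l, v, S⟩ =
      StateTransition.eval (TM2.step M) (TM2.stepAux (M l) v S) :=
  StateTransition.reaches_eval (.single rfl)

/-- The states that run the statements reachable from a finite set of labels. -/
def supportedStates (M : Λ → TM2.Stmt (fun _ : K => Γ) Λ σ) (A : Finset Λ) :
    Set (TM2.Stmt (fun _ : K => Γ) Λ σ × σ) :=
  {q | some q.1 ∈ TM2.stmts M A}

theorem finite_supportedStates [Finite σ] (A : Finset Λ) : (supportedStates M A).Finite := by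
  refine (((TM2.stmts M A).finite_toSet.preimage (Option.some_injective _).injOn).prod
    (Set.finite_univ (α := σ))).subset fun q hq => ⟨hq, trivial⟩

theorem mem_supportedStates_of_mem {A : Finset Λ} {l : Λ} (hl : l ∈ A) (v : σ) :
    (M l, v) ∈ supportedStates M A := by
  simp only [supportedStates, TM2.stmts, Set.mem_ofPred_eq, Finset.some_mem_insertNone,
    Finset.mem_biUnion]
  exact ⟨l, hl, TM2.stmts₁_self⟩

variable [Inhabited K]

/-- The stack machine that executes the statements of a `TM2` program one by one. -/
def ofTM2 (M : Λ → TM2.Stmt (fun _ : K => Γ) Λ σ) (l₀ : Λ) (v₀ : σ) :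
    StackMachine (TM2.Stmt (fun _ : K => Γ) Λ σ × σ) K Γ where
  start := (M l₀, v₀)
  sel
    | (.push k _ _, _) => k
    | (.peek k _ _, _) => k
    | (.pop k _ _, _) => k
    -- A statement that touches no stack observes the default one, and `out` puts its top symbol
    -- back.
    | _ => default
  out
    | (.push _ f _, v), o => f v :: o.toList
    | (.pop _ _ _, _), _ => []
    | _, o => o.toList
  next
    | (.push _ _ s, v), _ => (s, v)
    | (.peek _ f s, v), o => (s, f v o)
    | (.pop _ f s, v), o => (s, f v o)
    | (.load f s, v), _ => (s, f v)
    | (.branch p s₁ s₂, v), _ => (cond (p v) s₁ s₂, v)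
    | (.goto f, v), _ => (M (f v), v)
    | (.halt, v), _ => (.halt, v)
  halted q := q.1 = .halt

variable {l₀ : Λ} {v₀ : σ}

/-- Execution passes to a substatement or, at a `goto`, to the body of a label, which lies in `A` by
the support hypothesis. -/
theorem next_mem_supportedStates {A : Finset Λ} (hA : ∀ l ∈ A, TM2.SupportsStmt A (M l)) :
    ∀ q ∈ supportedStates M A, ∀ o, (ofTM2 M l₀ v₀).next q o ∈ supportedStates M A := by
  rintro ⟨s, v⟩ hs o
  have trans : ∀ t, t ∈ TM2.stmts₁ s → some t ∈ TM2.stmts M A := fun t ht =>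
    TM2.stmts_trans ht hs
  have self : ∀ t : TM2.Stmt (fun _ : K => Γ) Λ σ, t ∈ TM2.stmts₁ t := fun t => TM2.stmts₁_self
  cases s with
  | halt => exact hs
  | goto f =>
    have : TM2.SupportsStmt A (.goto f : TM2.Stmt (fun _ : K => Γ) Λ σ) := by
      simp only [supportedStates, TM2.stmts, Set.mem_ofPred_eq, Finset.some_mem_insertNone,
        Finset.mem_biUnion] at hs
      obtain ⟨l, hl, hs⟩ := hs
      exact TM2.stmts₁_supportsStmt_mono hs (hA l hl)
    exact mem_supportedStates_of_mem (this v) v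
  | branch p s₁ s₂ =>
    refine trans _ ?_
    cases hp : p v <;> simp [ofTM2, TM2.stmts₁, hp, self]
  | _ => exact trans _ (by simp [ofTM2, TM2.stmts₁, self])

variable [DecidableEq K]

/-- The configuration of the stack machine after one step. -/
theorem step_ofTM2 (s : TM2.Stmt (fun _ : K => Γ) Λ σ) (v : σ) (S : K → List Γ) :
    (ofTM2 M l₀ v₀).step ((s, v), S) = match s with
      | .push k f s => ((s, v), Function.update S k (f v :: S k))
      | .peek k f s => ((s, f v (S k).head?), S)
      | .pop k f s => ((s, f v (S k).head?), Function.update S k (S k).tail)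
      | .load f s => ((s, f v), S)
      | .branch p s₁ s₂ => ((cond (p v) s₁ s₂, v), S)
      | .goto f => ((M (f v), v), S)
      | .halt => ((.halt, v), S) := by
  cases s <;> simp [step, ofTM2, observed, toList_head?_append_tail]

/-- `TM2.stepAux` runs a statement up to its `goto` or `halt`. In the latter case no label results
and `h` is vacuous. -/
theorem halts_of_stepAux (s : TM2.Stmt (fun _ : K => Γ) Λ σ) (v : σ) (S : K → List Γ)
    (h : ∀ l, (TM2.stepAux s v S).l = some l → (ofTM2 M l₀ v₀).Halts
      ((M l, (TM2.stepAux s v S).var), (TM2.stepAux s v S).stk)) :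
    (ofTM2 M l₀ v₀).Halts ((s, v), S) := by
  induction s generalizing v S with
  | halt => exact ⟨0, rfl⟩
  | goto f => exact .of_step _ (by simpa [step_ofTM2] using h)
  | branch p s₁ s₂ ih₁ ih₂ =>
    refine .of_step _ ?_
    rw [step_ofTM2]
    cases hp : p v <;> simp only [TM2.stepAux, hp, cond] at h ⊢
    exacts [ih₂ _ _ h, ih₁ _ _ h]
  | push _ _ _ ih | peek _ _ _ ih | pop _ _ _ ih | load _ _ ih =>
    exact .of_step _ (by rw [step_ofTM2]; exact ih _ _ h)

theorem dom_eval_of_halted {n : ℕ} {s : TM2.Stmt (fun _ : K => Γ) Λ σ} {v : σ} {S : K → List Γ}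
    (h : (ofTM2 M l₀ v₀).halted ((ofTM2 M l₀ v₀).step^[n] ((s, v), S)).1) :
    (StateTransition.eval (TM2.step M) (TM2.stepAux s v S)).Dom := by
  induction n generalizing s v S with
  | zero =>
    obtain rfl : s = .halt := h
    exact Part.dom_iff_mem.2 ⟨_, StateTransition.mem_eval.2 ⟨.refl, rfl⟩⟩
  | succ n ih =>
    rw [Function.iterate_succ_apply, step_ofTM2] at h
    cases s with dsimp only at h
    -- The statement `halt` loops in the stack machine.
    | halt => exact ih h
    | goto f =>
      rw [TM2.stepAux, eval_step_some]
      exact ih h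
    | branch p s₁ s₂ =>
      cases hp : p v <;> simp only [TM2.stepAux, hp, cond] at h ⊢ <;> exact ih h
    | _ => rw [TM2.stepAux]; exact ih h

/-- The stack machine of a `TM2` program halts iff the program does. -/
theorem halts_ofTM2_iff (l : Λ) (v : σ) (S : K → List Γ) :
    (ofTM2 M l₀ v₀).Halts ((M l, v), S) ↔
      (StateTransition.eval (TM2.step M) ⟨some l, v, S⟩).Dom := by
  constructor
  · rintro ⟨n, h⟩
    rw [eval_step_some]
    exact dom_eval_of_halted h
  · intro h
    obtain ⟨b, hb⟩ := Part.dom_iff_mem.1 h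
    obtain ⟨hr, hb⟩ := StateTransition.mem_eval.1 hb
    suffices ∀ a, StateTransition.Reaches (TM2.step M) a b → ∀ l, a.l = some l →
        (ofTM2 M l₀ v₀).Halts ((M l, a.var), a.stk) from this _ hr l rfl
    intro a ha
    induction ha using Relation.ReflTransGen.head_induction_on with
    | refl =>
      intro l hl
      obtain ⟨_, v, S⟩ := b
      obtain rfl := hl
      simp at hb
    | head hac _ ih =>
      rename_i a c _
      intro l hl
      obtain ⟨_, v, S⟩ := a
      obtain rfl := hl
      simp only [TM2.step, Option.mem_def, Option.some.injEq] at hac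
      subst hac
      exact halts_of_stepAux _ _ _ ih

end StackMachine

open Turing PartrecToTM2 in
instance : Finite K' :=
  Finite.of_surjective ![K'.main, K'.rev, K'.aux, K'.stack] fun
    | .main => ⟨0, rfl⟩
    | .rev => ⟨1, rfl⟩
    | .aux => ⟨2, rfl⟩
    | .stack => ⟨3, rfl⟩

/-! ### Binary digits as a primitive recursive function. -/

/-- The successor of a number given by its binary digits, least significant digit first. -/
def binarySucc (l : List Bool) : List Bool :=
  l.rec [true] fun b l ih => cond b (false :: ih) (true :: l)

/-- The binary digits of a number, least significant digit first. -/
def binaryDigits (n : ℕ) : List Bool := n.rec [] fun _ => binarySucc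

theorem primrec_binarySucc : Primrec binarySucc := by
  refine Primrec.list_rec (h := fun _ x => cond x.1 (false :: x.2.2) (true :: x.2.1))
    Primrec.id (Primrec.const _) ?_
  refine Primrec.cond (Primrec.fst.comp Primrec.snd) ?_ ?_
  · exact Primrec.list_cons.comp (Primrec.const _)
      (Primrec.snd.comp (Primrec.snd.comp Primrec.snd))
  · exact Primrec.list_cons.comp (Primrec.const _)
      (Primrec.fst.comp (Primrec.snd.comp Primrec.snd))

theorem primrec_binaryDigits : Primrec binaryDigits :=
  Primrec.nat_rec₁ _ (primrec_binarySucc.comp Primrec.snd)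

namespace Turing.PartrecToTM2

/-- The stack symbol of a binary digit. -/
def bitSymbol (b : Bool) : Γ' := cond b .bit1 .bit0

theorem trPosNum_succ {p : PosNum} {l : List Bool} (h : trPosNum p = l.map bitSymbol) :
    trPosNum p.succ = (binarySucc l).map bitSymbol := by
  induction p generalizing l with
  | one =>
    match l, h with
    | [true], _ => rfl
  | bit0 p _ =>
    match l, h with
    | false :: l, h => exact congrArg (Γ'.bit1 :: ·) (List.cons.inj h).2
  | bit1 p ih =>
    match l, h with
    | true :: l, h => exact congrArg (Γ'.bit0 :: ·) (ih (List.cons.inj h).2)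

/-- This replaces the passage through `Num` by iteration of `binarySucc`, whose primitive
recursiveness is known. -/
theorem trNat_eq_map_binaryDigits (n : ℕ) : trNat n = (binaryDigits n).map bitSymbol := by
  induction n with
  | zero => simp [binaryDigits]
  | succ n ih =>
    rw [trNat] at ih ⊢
    rw [Nat.cast_succ, Num.add_one]
    change _ = (binarySucc (binaryDigits n)).map bitSymbol
    generalize (n : Num) = m at ih
    generalize binaryDigits n = l at ih
    cases m with
    | zero =>
      obtain rfl : l = [] := by simpa [trNum] using ih.symm
      rfl
    | pos p => exact trPosNum_succ ih

theorem primrec_map_trList {α : Type*} [Primcodable α] (e : Γ' → α) :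
    Primrec fun n : ℕ => (trList [n]).map e := by
  have : Primrec fun n : ℕ => (binaryDigits n).map (fun b => e (bitSymbol b)) ++ [e .cons] :=
    Primrec.list_append.comp (Primrec.list_map primrec_binaryDigits
      ((Primrec.dom_finite fun b => e (bitSymbol b)).comp Primrec.snd)) (Primrec.const _)
  refine this.of_eq fun n => ?_
  simp [trList, trNat_eq_map_binaryDigits, Function.comp_def]

end Turing.PartrecToTM2

/-! ### A fixed program with undecidable halting. -/

/-- There is a code whose halting set is not decidable. -/
theorem exists_code_undecidable :
    ∃ c : Turing.ToPartrec.Code, ¬ ComputablePred fun n : ℕ => (c.eval [n]).Dom := by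
  -- The universal function, which runs the program number `n` on input `0`.
  have hU : Partrec fun n : ℕ => (Denumerable.ofNat Nat.Partrec.Code n).eval 0 :=
    Nat.Partrec.Code.eval_part.comp (Computable.ofNat _) (Computable.const 0)
  obtain ⟨c, hc⟩ := Turing.ToPartrec.Code.exists_code (Nat.Partrec'.part_iff₁.2 hU)
  refine ⟨c, fun h => ComputablePred.halting_problem 0 ?_⟩
  obtain ⟨f, hf, e⟩ := ComputablePred.computable_iff.1 h
  refine ComputablePred.computable_iff.2 ⟨_, hf.comp Computable.encode, ?_⟩
  funext d
  have h₁ := congrFun e (Encodable.encode d)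
  have h₂ := hc (Encodable.encode d ::ᵥ .nil)
  simp only [List.Vector.head_cons, Denumerable.ofNat_encode] at h₂
  rw [← h₁]
  change _ = (c.eval [Encodable.encode d]).Dom
  have h₃ : c.eval [Encodable.encode d] = pure <$> Nat.Partrec.Code.eval d 0 := h₂
  rw [h₃]
  rfl

/-! ### Computability of the reduction. -/

theorem Primrec.flatMap_const {ι α β : Type*} [Primcodable α] [Primcodable β] (l : List ι)
    {f : α → ι → List β} (hf : ∀ i, Primrec fun a => f a i) :
    Primrec fun a => l.flatMap (f a) := by
  induction l with
  | nil => exact Primrec.const []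
  | cons i l ih =>
    exact (Primrec.list_append.comp (hf i) ih).of_eq fun a => by simp

theorem PDATransition.primrec_mk {α : Type*} [Primcodable α] (s : ℕ) (a : Option ℕ) (g p : ℕ)
    {f : α → List ℕ} (hf : Primrec f) : Primrec fun x => (⟨s, a, g, p, f x⟩ : PDATransition) :=
  ((Primrec.of_equiv_symm (e := PDATransition.equivTuple)).comp
    ((Primrec.const s).pair ((Primrec.const a).pair ((Primrec.const g).pair
      ((Primrec.const p).pair hf)))) :)

theorem PDA.primrec_mk {α : Type*} [Primcodable α] (nQ nA nG q b : ℕ) (F : List ℕ)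
    {f : α → List PDATransition} (hf : Primrec f) :
    Primrec fun x => (⟨nQ, nA, nG, q, b, F, f x⟩ : PDA) :=
  ((Primrec.of_equiv_symm (e := PDA.equivTuple)).comp
    ((Primrec.const nQ).pair ((Primrec.const nA).pair ((Primrec.const nG).pair
      ((Primrec.const q).pair ((Primrec.const b).pair ((Primrec.const F).pair hf)))))) :)

namespace StackMachine

variable {Q K Γ : Type*} [DecidableEq K]

noncomputable instance [Finite Q] [Finite K] : Fintype (CheckState Q K) := Fintype.ofFinite _

noncomputable instance [Finite K] [Finite Γ] : Fintype (CheckLetter K Γ) := Fintype.ofFinite _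

/-- The description of the history checker depends on the initial stacks in a computable way. -/
theorem primrec_toPDA_checker [Finite Q] [Fintype K] [Fintype Γ] (M : StackMachine Q K Γ)
    (i₀ : K) {S₀ : ℕ → K → List Γ}
    (hS : ∀ (i : K) (e : Γ → ℕ), Primrec fun n => (S₀ n i).map e) :
    Primrec fun n => (M.checker (S₀ n) i₀).toPDA := by
  suffices ∀ x, Primrec fun n => (M.checker (S₀ n) i₀).transitionsAt x by
    unfold DetPushdown.toPDA
    exact PDA.primrec_mk _ _ _ (DetPushdown.num (CheckState.load : CheckState Q K))
      (DetPushdown.num (.inr i₀ : Γ ⊕ K)) _ (Primrec.flatMap_const _ this)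
  have const : ∀ x : CheckState Q K × Option (CheckLetter K Γ) × (Γ ⊕ K),
      (∀ S S', M.checkStep S x.1 x.2.1 x.2.2 = M.checkStep S' x.1 x.2.1 x.2.2) →
      Primrec fun n => (M.checker (S₀ n) i₀).transitionsAt x := by
    intro x hx
    refine (Primrec.const ((M.checker (S₀ 0) i₀).transitionsAt x)).of_eq fun n => ?_
    simp only [DetPushdown.transitionsAt, checker, hx (S₀ n) (S₀ 0)]
  rintro ⟨p, a, g⟩
  -- Only `enter` uses the initial stacks. All other transitions are constant in `n`.
  by_cases hp : p = .enter
  · subst hp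
    rcases a with _ | a
    · rcases g with g | i
      · exact const _ fun _ _ => rfl
      · have hpush : Primrec fun n => (S₀ n i).map (fun x => DetPushdown.num (.inl x : Γ ⊕ K)) ++
            [DetPushdown.num (.inr i : Γ ⊕ K)] :=
          Primrec.list_append.comp (hS i fun x => DetPushdown.num (.inl x : Γ ⊕ K))
            (Primrec.const [DetPushdown.num (.inr i : Γ ⊕ K)])
        have htrans := PDATransition.primrec_mk
          (DetPushdown.num (CheckState.enter : CheckState Q K)) none
          (DetPushdown.num (.inr i : Γ ⊕ K)) (DetPushdown.num (CheckState.run i M.start)) hpush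
        have hlist := Primrec.list_cons.comp htrans (Primrec.const [])
        refine hlist.of_eq fun n => ?_
        simp [DetPushdown.transitionsAt, checker, checkStep, Function.comp_def]
    · exact const _ fun _ _ => by rcases g with g | g <;> rfl
  · refine const _ fun S S' => ?_
    rcases p with _ | _ | _ | _ | ⟨i, q⟩
    case enter => exact absurd rfl hp
    all_goals rcases a with _ | (_ | _ | _ | _) <;> rcases g with g | g <;> rfl

end StackMachine

open Turing PartrecToTM2 StackMachine in
/-- A stack machine with finitely many control states whose halting on the stacks that represent
a number is undecidable. -/
theorem exists_stackMachine_undecidable :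
    ∃ (Q : Type) (_ : Finite Q) (M : StackMachine Q K' Γ'),
      ¬ ComputablePred fun n : ℕ => M.Halts (M.start, K'.elim (trList [n]) [] [] []) := by
  obtain ⟨c, hc⟩ := exists_code_undecidable
  have hsupp := tr_supports c .halt
  have h₀ : (ofTM2 tr (trNormal c .halt) none).start ∈ supportedStates tr (codeSupp c .halt) :=
    mem_supportedStates_of_mem hsupp.1 none
  have hnext := next_mem_supportedStates (l₀ := trNormal c .halt) (v₀ := none) hsupp.2
  refine ⟨_, (finite_supportedStates _).to_subtype, (ofTM2 tr _ none).restrict _ h₀ hnext, ?_⟩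
  convert hc using 3 with n
  refine (halts_restrict _ h₀ hnext _ _).trans ((halts_ofTM2_iff _ _ _).trans ?_)
  change (StateTransition.eval (TM2.step tr) (init c [n])).Dom ↔ _
  -- The result of the program is the image of `c.eval [n]` under a total map, so the domains agree.
  rw [tr_eval]
  rfl

theorem proposition9 :
    ¬ DecidableProblem PDA.IsDPDA (fun M : PDA => IsInfixDense M.language) := by
  rintro ⟨f, hf, hfS⟩
  obtain ⟨Q, _, M, hM⟩ := exists_stackMachine_undecidable
  let S₀ (n : ℕ) := Turing.PartrecToTM2.K'.elim (Turing.PartrecToTM2.trList [n]) [] [] []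
  have : Fintype Turing.PartrecToTM2.K' := Fintype.ofFinite _
  let A (n : ℕ) : PDA := (M.checker (S₀ n) .main).toPDA
  have hA : Primrec A := by
    refine M.primrec_toPDA_checker _ fun i e => ?_
    cases i with
    | main => exact Turing.PartrecToTM2.primrec_map_trList e
    | _ => exact Primrec.const []
  have key : ∀ n, ∃ b : Bool, b ∈ f (A n) ∧ (b = true ↔ ¬ M.Halts (M.start, S₀ n)) := by
    intro n
    obtain ⟨b, hb, h⟩ := hfS (A n) (DetPushdown.isDPDA_toPDA _)
    exact ⟨b, hb, h.trans ((DetPushdown.isInfixDense_toPDA _).trans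
      StackMachine.checker_infixDense_iff)⟩
  choose g hg hgM using key
  -- Every `A n` is a deterministic automaton, so `f` converges on all of them and its composite
  -- with `A` is total.
  have hgc : Computable g :=
    (hf.comp hA.to_comp).of_eq fun n => Part.eq_some_iff.2 (hg n)
  refine hM (ComputablePred.computable_iff.2 ⟨_, Primrec.not.to_comp.comp hgc, ?_⟩)
  funext n
  have := hgM n
  cases hn : g n <;> simp_all [S₀]
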